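/- Let $A$ be a $C^*$-algebra with a countable approximate identity, and let $a\in A$ be a strictly positive element, that is, an element such that $aAa$ is dense in $A$. Let $\mathrm{Prim}(A)$ be the set of primitive ideals of $A$ (the kernels of the nonzero irreducible $*$-representations of $A$ on Hilbert spaces) with the hull-kernel topology, and write $P\approx Q$ for $P,Q\in\mathrm{Prim}(A)$ if $f(P)=f(Q)$ for every bounded continuous function $f:\mathrm{Prim}(A)\to\mathbb{R}$. Let $\mathrm{Glimm}(A)$ be the set of the ideals $q_A(P):=\bigcap\{Q\in\mathrm{Prim}(A) : Q\approx P\}$, $P\in \mathrm{Prim}(A)$, with the topology $\tau_{cr}$, the weakest topology for which every function $g:\mathrm{Glimm}(A)\to\mathbb{R}$ such that $g\circ q_A$ is bounded and continuous on $\mathrm{Prim}(A)$ is continuous. Then for every $\tau_{cr}$-compact subset $K$ of $\mathrm{Glimm}(A)$ there exists $\alpha>0$ such that $$K\subset\{G\in\mathrm{Glimm}(A) : \|a+G\|\geq\alpha\},$$ where $\|a+G\|$ is the norm of the image of $a$ in the quotient $A/G$. -/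

import Mathlib

open Filter Topology
open scoped BoundedContinuousFunction

universe u

namespace GlimmSpace

/-- A (topologically) irreducible representation of a `C⋆`-algebra on a Hilbert space: a nonzero
`⋆`-representation whose only closed invariant subspaces are `0` and the whole space. -/
structure IsIrreducibleRep {A : Type u} [NonUnitalCStarAlgebra A]
    {H : Type u} [NormedAddCommGroup H] [InnerProductSpace ℂ H] [CompleteSpace H]
    (π : A →⋆ₙₐ[ℂ] (H →L[ℂ] H)) : Prop where
  ne_zero : ∃ x : A, π x ≠ 0
  eq_bot_or_eq_top : ∀ V : Submodule ℂ H, IsClosed (V : Set H) →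
    (∀ x : A, ∀ v ∈ V, π x v ∈ V) → V = ⊥ ∨ V = ⊤

/-- A primitive ideal is the kernel of an irreducible representation. (The space of an irreducible
representation of `A` is the completion of a quotient of `A`, so that the universe of `A` is
large enough.) -/
def IsPrimitiveIdeal {A : Type u} [NonUnitalCStarAlgebra A] (P : TwoSidedIdeal A) : Prop :=
  ∃ (H : Type u) (_ : NormedAddCommGroup H) (_ : InnerProductSpace ℂ H) (_ : CompleteSpace H)
    (π : A →⋆ₙₐ[ℂ] (H →L[ℂ] H)), IsIrreducibleRep π ∧ P = TwoSidedIdeal.ker π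

/-- The set `Prim(A)` of primitive ideals of `A`. -/
def Prim (A : Type u) [NonUnitalCStarAlgebra A] : Type u :=
  {P : TwoSidedIdeal A // IsPrimitiveIdeal P}

/-- The hull of an ideal: the primitive ideals that contain it. -/
def hull {A : Type u} [NonUnitalCStarAlgebra A] (I : TwoSidedIdeal A) : Set (Prim A) :=
  {P | I ≤ P.1}

theorem IsPrimitiveIdeal.ne_top {A : Type u} [NonUnitalCStarAlgebra A] {P : TwoSidedIdeal A}
    (hP : IsPrimitiveIdeal P) : ¬ (⊤ : TwoSidedIdeal A) ≤ P := by
  obtain ⟨H, _, _, _, π, hπ, rfl⟩ := hP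
  intro h
  obtain ⟨x, hx⟩ := hπ.ne_zero
  exact hx ((TwoSidedIdeal.mem_ker π).1 (h (TwoSidedIdeal.mem_top A)))

/-- Primitive ideals are prime. -/
theorem IsPrimitiveIdeal.prime {A : Type u} [NonUnitalCStarAlgebra A] {P : TwoSidedIdeal A}
    (hP : IsPrimitiveIdeal P) {I J : TwoSidedIdeal A} (h : I ⊓ J ≤ P) : I ≤ P ∨ J ≤ P := by
  obtain ⟨H, _, _, _, π, hπ, rfl⟩ := hP
  let W : Submodule ℂ H := ⨅ c : I, LinearMap.ker (π c.1 : H →ₗ[ℂ] H)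
  have mem_W : ∀ v, v ∈ W ↔ ∀ c ∈ I, π c v = 0 := fun v => by
    simp [W, Submodule.mem_iInf]
  have hclosed : IsClosed (W : Set H) := by
    have : (W : Set H) = ⋂ c : I, {v | π c.1 v = 0} := by
      ext v; simp [mem_W]
    rw [this]
    exact isClosed_iInter fun c => isClosed_eq (π c.1).continuous continuous_const
  have hinv : ∀ x : A, ∀ v ∈ W, π x v ∈ W := fun x v hv => by
    rw [mem_W] at hv ⊢
    intro c hc
    have := hv (c * x) (I.mul_mem_right c x hc)
    rwa [map_mul] at this
  rcases hπ.eq_bot_or_eq_top W hclosed hinv with hW | hW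
  · right
    intro y hy
    rw [TwoSidedIdeal.mem_ker]
    ext v
    have hv : π y v ∈ W := (mem_W _).2 fun c hc => by
      have hm : c * y ∈ TwoSidedIdeal.ker π :=
        h ((TwoSidedIdeal.mem_inf A).2 ⟨I.mul_mem_right c y hc, J.mul_mem_left c y hy⟩)
      rw [TwoSidedIdeal.mem_ker, map_mul] at hm
      exact congrArg (fun T : H →L[ℂ] H => T v) hm
    rw [hW] at hv
    simpa using hv
  · left
    intro c hc
    rw [TwoSidedIdeal.mem_ker]
    ext v
    have hv : v ∈ W := hW ▸ Submodule.mem_top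
    simpa using (mem_W v).1 hv c hc

/-- The hull-kernel (Jacobson) topology on `Prim(A)`: the closed sets are the hulls of ideals. -/
instance (A : Type u) [NonUnitalCStarAlgebra A] : TopologicalSpace (Prim A) :=
  TopologicalSpace.ofClosed (Set.range (hull (A := A)))
    ⟨⊤, by
      ext P
      simpa [hull] using P.2.ne_top⟩
    (fun S hS => ⟨sSup {I | hull I ∈ S}, by
      ext P
      simp only [hull, Set.mem_ofPred_eq, Set.mem_sInter, sSup_le_iff]
      constructor
      · intro h t ht
        obtain ⟨I, rfl⟩ := hS ht
        exact h I ht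
      · intro h I hI
        exact h _ hI⟩)
    (by
      rintro _ ⟨I, rfl⟩ _ ⟨J, rfl⟩
      refine ⟨I ⊓ J, ?_⟩
      ext P
      change I ⊓ J ≤ P.1 ↔ I ≤ P.1 ∨ J ≤ P.1
      exact ⟨P.2.prime, fun h => h.elim inf_le_left.trans inf_le_right.trans⟩)

theorem isClosed_iff_hull {A : Type u} [NonUnitalCStarAlgebra A] {F : Set (Prim A)} :
    IsClosed F ↔ ∃ I : TwoSidedIdeal A, hull I = F := by
  rw [← isOpen_compl_iff]
  change Fᶜᶜ ∈ Set.range (hull (A := A)) ↔ _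
  rw [compl_compl]
  rfl

/-- `P ≈ Q` if no bounded continuous real function on `Prim(A)` separates `P` from `Q`. -/
def Equivalent {A : Type u} [NonUnitalCStarAlgebra A] (P Q : Prim A) : Prop :=
  ∀ f : Prim A →ᵇ ℝ, f P = f Q

/-- The kernel of the equivalence class of `P`, i.e. the intersection of the primitive ideals
equivalent to `P`. -/
def glimmIdeal {A : Type u} [NonUnitalCStarAlgebra A] (P : Prim A) : TwoSidedIdeal A :=
  sInf {I | ∃ Q : Prim A, Equivalent P Q ∧ I = Q.1}

/-- The set `Glimm(A)` of the kernels of the equivalence classes. -/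
def Glimm (A : Type u) [NonUnitalCStarAlgebra A] : Type u :=
  {G : TwoSidedIdeal A // ∃ P : Prim A, glimmIdeal P = G}

/-- The quotient map `q_A : Prim(A) → Glimm(A)`. -/
def quotientMap {A : Type u} [NonUnitalCStarAlgebra A] (P : Prim A) : Glimm A :=
  ⟨glimmIdeal P, P, rfl⟩

/-- `Glimm(A)` is the quotient of `Prim(A)` by the equivalence relation; in particular, every
bounded continuous function on `Prim(A)` drops to `Glimm(A)`. -/
theorem quotientMap_eq_iff {A : Type u} [NonUnitalCStarAlgebra A] {P Q : Prim A} :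
    quotientMap P = quotientMap Q ↔ Equivalent P Q := by
  constructor
  · intro h
    have h' : glimmIdeal P = glimmIdeal Q := congrArg Subtype.val h
    have hc : IsClosed {R : Prim A | Equivalent P R} := by
      have : {R : Prim A | Equivalent P R} = ⋂ f : Prim A →ᵇ ℝ, {R | f P = f R} := by
        ext R; simp [Equivalent]
      rw [this]
      exact isClosed_iInter fun f => isClosed_eq continuous_const f.continuous
    obtain ⟨I, hI⟩ := isClosed_iff_hull.1 hc
    have h1 : I ≤ glimmIdeal P := by
      refine le_sInf ?_
      rintro _ ⟨R, hR, rfl⟩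
      have : R ∈ hull I := hI ▸ hR
      exact this
    have h2 : glimmIdeal Q ≤ Q.1 := sInf_le ⟨Q, fun _ => rfl, rfl⟩
    have : Q ∈ hull I := (h1.trans h'.le).trans h2
    rw [hI] at this
    exact this
  · intro h
    refine Subtype.ext ?_
    have : ∀ R, Equivalent P R ↔ Equivalent Q R := fun R =>
      ⟨fun k f => (h f).symm.trans (k f), fun k f => (h f).trans (k f)⟩
    simp only [quotientMap, glimmIdeal, this]

/-- The topology `τ_cr` on `Glimm(A)`: the weakest one for which the functions obtained by dropping
to `Glimm(A)` the bounded continuous real functions on `Prim(A)` are continuous. -/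
instance (A : Type u) [NonUnitalCStarAlgebra A] : TopologicalSpace (Glimm A) :=
  ⨅ g ∈ {g : Glimm A → ℝ | ∃ f : Prim A →ᵇ ℝ, ∀ P, g (quotientMap P) = f P},
    TopologicalSpace.induced g inferInstance

/-- The norm `‖x + I‖` of the image of `x` in the quotient `A / I`. -/
noncomputable def quotientNorm {A : Type u} [NonUnitalCStarAlgebra A] (x : A)
    (I : TwoSidedIdeal A) : ℝ :=
  ‖(QuotientAddGroup.mk x : A ⧸ AddSubgroup.ofClass I)‖

/-- `A` is `σ`-unital: it has a (two-sided) countable approximate identity. -/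
def HasCountableApproximateIdentity (A : Type u) [NonUnitalCStarAlgebra A] : Prop :=
  ∃ e : ℕ → A, (Filter.map e atTop).IsApproximateUnit

/-- The element `a` is strictly positive in the sense that `aAa` is dense in `A`. (That `a` be
positive, as is usual, is not required.) -/
def IsStrictlyPositiveElement {A : Type u} [NonUnitalCStarAlgebra A] (a : A) : Prop :=
  Dense {y : A | ∃ x : A, y = a * x * a}

end GlimmSpace

/-!
The states of the unitization that vanish on an ideal `I` take the maximal value `‖x + I‖ ^ 2` at
`star x * x`, and some extreme one among them attains it. Its GNS representation is irreducible, so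
`‖x + I‖` is attained as `‖x + P‖` at a primitive ideal `P` containing `I`. It follows that
`{P | ε ≤ ‖x + P‖}` is compact for `0 < ε`; by functional calculus `{P | ε < ‖x + P‖}` is open.

If `‖a + G‖` is not bounded below on `K`, choose `P n` over `K` with `‖a + q (P n)‖ < 1 / (n + 1)`.
No `Q` in the compact set `{Q | 1 / (n + 1) ≤ ‖a + Q‖}` is equivalent to `P n`, so some continuous
`f n ≥ 0` takes the value `1` at `P n` and vanishes on that set. As `a` lies in no primitive ideal,
the supports of the `f n` form a locally finite family, and `∑ n, n * f n` is continuous. A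
continuous function on `Prim A` is bounded above on the preimage of a compact subset of `Glimm A`,
but this sum is at least `n` at `P n`.
-/

open scoped ComplexOrder ComplexStarModule CStarAlgebra InnerProductSpace

namespace GlimmSpace

section VectorFunctional

variable {B : Type*} [CStarAlgebra B] {H : Type*} [NormedAddCommGroup H]
  [InnerProductSpace ℂ H] [CompleteSpace H] (π : B →⋆ₐ[ℂ] (H →L[ℂ] H))

/-- The functional `x ↦ ⟪v, π x v⟫` of a vector `v` in the space of a representation `π`, as an
element of the weak dual, where the state space is compact. -/
noncomputable def vectorFunctional (v : H) : WeakDual ℂ B where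
  toFun x := ⟪v, π x v⟫_ℂ
  map_add' x y := by simp
  map_smul' r x := by simp
  cont := by
    have : Continuous π := map_continuous π
    fun_prop

@[simp]
theorem vectorFunctional_apply (v : H) (x : B) : vectorFunctional π v x = ⟪v, π x v⟫_ℂ := rfl

theorem vectorFunctional_one (v : H) : vectorFunctional π v 1 = (‖v‖ : ℂ) ^ 2 := by
  simp [inner_self_eq_norm_sq_to_K]

theorem norm_eq_one_of_vectorFunctional_one {π : B →⋆ₐ[ℂ] (H →L[ℂ] H)} {v : H}
    (h : vectorFunctional π v 1 = 1) : ‖v‖ = 1 := by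
  rw [vectorFunctional_one] at h
  exact (pow_eq_one_iff_of_nonneg (norm_nonneg v) two_ne_zero).1 (by exact_mod_cast h)

theorem norm_vectorFunctional_apply_le (v : H) (x : B) :
    ‖vectorFunctional π v x‖ ≤ ‖v‖ ^ 2 * ‖x‖ :=
  calc ‖⟪v, π x v⟫_ℂ‖ ≤ ‖v‖ * (‖π x‖ * ‖v‖) :=
        (norm_inner_le_norm _ _).trans (by gcongr; exact (π x).le_opNorm v)
    _ ≤ ‖v‖ * (‖x‖ * ‖v‖) := by gcongr; exact NonUnitalStarAlgHom.norm_apply_le π x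
    _ = ‖v‖ ^ 2 * ‖x‖ := by ring

theorem inner_apply_right (x : B) (v w : H) : ⟪v, π x w⟫_ℂ = ⟪π (star x) v, w⟫_ℂ := by
  rw [map_star, ContinuousLinearMap.star_eq_adjoint, ContinuousLinearMap.adjoint_inner_left]

theorem vectorFunctional_star_mul_self (v : H) (x : B) :
    vectorFunctional π v (star x * x) = (‖π x v‖ : ℂ) ^ 2 := by
  rw [vectorFunctional_apply, map_mul, mul_apply_eq_comp, inner_apply_right, star_star,
    inner_self_eq_norm_sq_to_K]
  rfl

end VectorFunctional

section GNS

variable {B : Type*} [CStarAlgebra B] [PartialOrder B] [StarOrderedRing B] (f : B →ₚ[ℂ] ℂ)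

/-- The canonical cyclic vector of the GNS representation of `f`, namely the class of `1`. -/
noncomputable def cyclicVector : f.GNS := ((f.toPreGNS 1 : f.PreGNS) : f.GNS)

theorem gnsStarAlgHom_cyclicVector (x : B) :
    f.gnsStarAlgHom x (cyclicVector f) = ((f.toPreGNS x : f.PreGNS) : f.GNS) := by
  simp [cyclicVector]

theorem denseRange_gnsStarAlgHom_cyclicVector :
    DenseRange fun x => f.gnsStarAlgHom x (cyclicVector f) := by
  simp only [gnsStarAlgHom_cyclicVector]
  exact UniformSpace.Completion.denseRange_coe.comp f.toPreGNS.surjective.denseRange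
    (UniformSpace.Completion.continuous_coe _)

theorem vectorFunctional_cyclicVector (x : B) :
    vectorFunctional f.gnsStarAlgHom (cyclicVector f) x = f x := by
  rw [vectorFunctional_apply, gnsStarAlgHom_cyclicVector, cyclicVector,
    UniformSpace.Completion.inner_coe, PositiveLinearMap.preGNS_inner_def]
  simp

theorem gnsStarAlgHom_eq_zero {T : Ideal B} [T.IsTwoSided] (hf : ∀ s ∈ T, f s = 0) {s : B}
    (hs : s ∈ T) : f.gnsStarAlgHom s = 0 := by
  refine ContinuousLinearMap.coeFn_injective <|
    (denseRange_gnsStarAlgHom_cyclicVector f).equalizer (by fun_prop) (by fun_prop)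
      (funext fun x => ?_)
  have h0 : f (star (s * x) * (s * x)) = 0 := hf _ (T.mul_mem_left _ (T.mul_mem_right _ hs))
  rw [← vectorFunctional_cyclicVector, vectorFunctional_star_mul_self] at h0
  simpa using h0

end GNS

section States

variable {B : Type*} [CStarAlgebra B] [PartialOrder B] [StarOrderedRing B]

/-- The states of `B` that vanish on `T`. -/
def statesVanishingOn (T : Set B) : Set (WeakDual ℂ B) :=
  {φ | (∀ x, 0 ≤ x → 0 ≤ φ x) ∧ φ 1 = 1 ∧ ∀ s ∈ T, φ s = 0}

theorem exists_positiveLinearMap_eq {φ : WeakDual ℂ B} (hφ : ∀ x, 0 ≤ x → 0 ≤ φ x) :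
    ∃ f : B →ₚ[ℂ] ℂ, ∀ x, f x = φ x :=
  ⟨PositiveLinearMap.mk₀ (φ : B →ₗ[ℂ] ℂ) hφ, fun _ => rfl⟩

theorem norm_apply_le_of_mem_statesVanishingOn {T : Set B} {φ : WeakDual ℂ B}
    (hφ : φ ∈ statesVanishingOn T) (x : B) : ‖φ x‖ ≤ ‖x‖ := by
  obtain ⟨f, hf⟩ := exists_positiveLinearMap_eq hφ.1
  have hΩ : ‖cyclicVector f‖ = 1 := norm_eq_one_of_vectorFunctional_one
    (π := f.gnsStarAlgHom) (by rw [vectorFunctional_cyclicVector, hf, hφ.2.1])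
  simpa only [vectorFunctional_cyclicVector, hf, hΩ, one_pow, one_mul] using
    norm_vectorFunctional_apply_le f.gnsStarAlgHom (cyclicVector f) x

theorem isCompact_statesVanishingOn (T : Set B) : IsCompact (statesVanishingOn T) := by
  refine (WeakDual.isCompact_closedBall (𝕜 := ℂ) (0 : StrongDual ℂ B) 1).of_isClosed_subset ?_
    fun φ hφ => ?_
  · simp only [statesVanishingOn, Set.ofPred_and, Set.ofPred_forall]
    have h (x : B) := WeakDual.eval_continuous (𝕜 := ℂ) x
    exact (isClosed_iInter fun x => isClosed_iInter fun _ =>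
      isClosed_Ici.preimage (h x)).inter ((isClosed_singleton.preimage (h 1)).inter
        (isClosed_iInter fun s => isClosed_iInter fun _ => isClosed_singleton.preimage (h s)))
  · rw [Set.mem_preimage, mem_closedBall_zero_iff]
    exact ContinuousLinearMap.opNorm_le_bound _ zero_le_one fun x => by
      simpa using norm_apply_le_of_mem_statesVanishingOn hφ x

theorem vectorFunctional_mem_statesVanishingOn {H : Type*} [NormedAddCommGroup H]
    [InnerProductSpace ℂ H] [CompleteSpace H] {π : B →⋆ₐ[ℂ] (H →L[ℂ] H)} {T : Set B}
    (hT : ∀ s ∈ T, π s = 0) {v : H} (hv : ‖v‖ = 1) :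
    vectorFunctional π v ∈ statesVanishingOn T := by
  refine ⟨fun x hx => ?_, ?_, fun s hs => ?_⟩
  · obtain ⟨y, rfl⟩ := CStarAlgebra.nonneg_iff_eq_star_mul_self.1 hx
    rw [vectorFunctional_star_mul_self]
    positivity
  · rw [vectorFunctional_one, hv]; simp
  · simp [hT s hs]

end States

section Irreducible

variable {B : Type*} [CStarAlgebra B] {H : Type*} [NormedAddCommGroup H] [InnerProductSpace ℂ H]
  [CompleteSpace H] {π : B →⋆ₐ[ℂ] (H →L[ℂ] H)} {Ω : H} {V : Submodule ℂ H}

theorem eq_top_of_mem_of_denseRange (hΩ : DenseRange fun x => π x Ω)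
    (hV : IsClosed (V : Set H)) (hinv : ∀ x, ∀ v ∈ V, π x v ∈ V) (hmem : Ω ∈ V) : V = ⊤ :=
  Submodule.eq_top_iff'.2 fun v =>
    closure_minimal (Set.range_subset_iff.2 fun x => hinv x Ω hmem) hV (hΩ v)

theorem apply_mem_orthogonal (hinv : ∀ x, ∀ v ∈ V, π x v ∈ V) (x : B) {w : H} (hw : w ∈ Vᗮ) :
    π x w ∈ Vᗮ := by
  intro v hv
  rw [inner_apply_right]
  exact hw _ (hinv _ v hv)

theorem inner_apply_add_of_mem_orthogonal (hinv : ∀ x, ∀ v ∈ V, π x v ∈ V) {v w : H}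
    (hv : v ∈ V) (hw : w ∈ Vᗮ) (x : B) : ⟪v, π x (v + w)⟫_ℂ = vectorFunctional π v x := by
  rw [map_add, inner_add_right, apply_mem_orthogonal hinv x hw v hv, add_zero,
    vectorFunctional_apply]

theorem vectorFunctional_add_of_mem_orthogonal (hinv : ∀ x, ∀ v ∈ V, π x v ∈ V) {v w : H}
    (hv : v ∈ V) (hw : w ∈ Vᗮ) :
    vectorFunctional π (v + w) = vectorFunctional π v + vectorFunctional π w := by
  refine DFunLike.ext _ _ fun x => ?_
  have hwv : ⟪w, π x v⟫_ℂ = 0 := Submodule.inner_left_of_mem_orthogonal (hinv x v hv) hw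
  change ⟪v + w, π x (v + w)⟫_ℂ = vectorFunctional π v x + ⟪w, π x w⟫_ℂ
  rw [inner_add_left, inner_apply_add_of_mem_orthogonal hinv hv hw, map_add, inner_add_right, hwv,
    zero_add]

theorem vectorFunctional_eq_smul_normalize {v : H} (hv : v ≠ 0) :
    vectorFunctional π v = ‖v‖ ^ 2 • vectorFunctional π ((‖v‖ : ℂ)⁻¹ • v) := by
  refine DFunLike.ext _ _ fun x => ?_
  change ⟪v, π x v⟫_ℂ = (‖v‖ ^ 2) • ⟪(‖v‖ : ℂ)⁻¹ • v, π x ((‖v‖ : ℂ)⁻¹ • v)⟫_ℂ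
  have hv' : (‖v‖ : ℂ) ≠ 0 := by simpa using hv
  rw [map_smul, inner_smul_left, inner_smul_right, Complex.real_smul]
  simp only [map_inv₀, Complex.conj_ofReal, Complex.ofReal_pow]
  field_simp

theorem eq_smul_of_vectorFunctional_eq_smul (hΩ : DenseRange fun x => π x Ω)
    (hinv : ∀ x, ∀ v ∈ V, π x v ∈ V) {v w : H} (hv : v ∈ V) (hw : w ∈ Vᗮ) (hvw : v + w = Ω) {r : ℝ}
    (h : vectorFunctional π v = r • vectorFunctional π Ω) : v = (r : ℂ) • Ω := by
  rw [← sub_eq_zero, ← inner_self_eq_zero (𝕜 := ℂ)]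
  suffices h0 : (fun y => ⟪v - (r : ℂ) • Ω, y⟫_ℂ) = fun _ => 0 from congrFun h0 _
  refine hΩ.equalizer (by fun_prop) (by fun_prop) (funext fun x => ?_)
  have hx : ⟪v, π x Ω⟫_ℂ = r * ⟪Ω, π x Ω⟫_ℂ := by
    rw [← hvw, inner_apply_add_of_mem_orthogonal hinv hv hw, h, hvw]
    rfl
  rw [Function.comp_apply, inner_sub_left, inner_smul_left, Complex.conj_ofReal, hx, sub_self]
  rfl

variable [PartialOrder B] [StarOrderedRing B] {T : Set B}

theorem vectorFunctional_eq_smul_of_mem_extremePoints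
    (hT : ∀ s ∈ T, π s = 0)
    (hext : vectorFunctional π Ω ∈ (statesVanishingOn T).extremePoints ℝ)
    (hinv : ∀ x, ∀ v ∈ V, π x v ∈ V) {v w : H} (hv : v ∈ V) (hw : w ∈ Vᗮ) (hΩ : v + w = Ω)
    (hv0 : v ≠ 0) (hw0 : w ≠ 0) : vectorFunctional π v = ‖v‖ ^ 2 • vectorFunctional π Ω := by
  have hstate {u : H} (hu : u ≠ 0) :
      vectorFunctional π ((‖u‖ : ℂ)⁻¹ • u) ∈ statesVanishingOn T :=
    vectorFunctional_mem_statesVanishingOn hT (norm_smul_inv_norm hu)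
  have hsplit : vectorFunctional π v + vectorFunctional π w = vectorFunctional π Ω := by
    rw [← vectorFunctional_add_of_mem_orthogonal hinv hv hw, hΩ]
  have hnorm : ‖v‖ ^ 2 + ‖w‖ ^ 2 = 1 := by
    have h1 := congrArg (fun φ : WeakDual ℂ B => φ 1) hsplit
    rw [hext.1.2.1] at h1
    have h2 : vectorFunctional π v 1 + vectorFunctional π w 1 = 1 := h1
    rw [vectorFunctional_one, vectorFunctional_one] at h2
    exact_mod_cast h2
  have hv1 := hext.2 (hstate hv0) (hstate hw0)
    ⟨‖v‖ ^ 2, ‖w‖ ^ 2, by positivity, by positivity, hnorm, by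
      rw [← vectorFunctional_eq_smul_normalize hv0, ← vectorFunctional_eq_smul_normalize hw0,
        hsplit]⟩
  rw [vectorFunctional_eq_smul_normalize hv0, hv1]

theorem eq_bot_or_eq_top_of_mem_extremePoints (hT : ∀ s ∈ T, π s = 0)
    (hΩ : DenseRange fun x => π x Ω)
    (hext : vectorFunctional π Ω ∈ (statesVanishingOn T).extremePoints ℝ)
    (hV : IsClosed (V : Set H)) (hinv : ∀ x, ∀ v ∈ V, π x v ∈ V) : V = ⊥ ∨ V = ⊤ := by
  have : CompleteSpace V := hV.completeSpace_coe
  obtain ⟨v, hv, w, hw, hvw⟩ := V.exists_add_mem_mem_orthogonal Ω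
  by_cases hv0 : v = 0
  · left
    rw [hv0, zero_add] at hvw
    rw [← V.orthogonal_eq_top_iff]
    exact eq_top_of_mem_of_denseRange hΩ V.isClosed_orthogonal
      (fun x _ => apply_mem_orthogonal hinv x) (hvw ▸ hw)
  · right
    refine eq_top_of_mem_of_denseRange hΩ hV hinv ?_
    by_cases hw0 : w = 0
    · rwa [hvw, hw0, add_zero]
    · have hvΩ := eq_smul_of_vectorFunctional_eq_smul hΩ hinv hv hw hvw.symm
        (vectorFunctional_eq_smul_of_mem_extremePoints hT hext hinv hv hw hvw.symm hv0 hw0)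
      have hr : ((‖v‖ ^ 2 : ℝ) : ℂ) ≠ 0 := by
        exact_mod_cast (by positivity : ‖v‖ ^ 2 ≠ 0)
      rw [← inv_smul_smul₀ hr Ω, ← hvΩ]
      exact V.smul_mem _ hv

end Irreducible

section IdealDistance

variable {B : Type*} [CStarAlgebra B] {T : Ideal B} [T.IsTwoSided] {c : B} {R : ℝ}

/-- A rational substitute for `√R / √(t + R)`: it equals `1` at `t = 0`, and
`cutoff R t ^ 2 * (R + t) ≤ R` for all `t`. If `star c * c ≤ R + s`, then multiplying `c` by
`cutoff R s` brings its norm down to at most `√R` without changing `c` modulo the ideal of `s`. -/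
noncomputable def cutoff (R t : ℝ) : ℝ := 4 * R ^ 2 / ((t + R) ^ 2 + 3 * R ^ 2)

theorem cutoff_eq (hR : 0 < R) (t : ℝ) :
    cutoff R t = 1 - t * ((t + 2 * R) / ((t + R) ^ 2 + 3 * R ^ 2)) := by
  have : (t + R) ^ 2 + 3 * R ^ 2 ≠ 0 := by positivity
  rw [cutoff]
  field_simp
  ring

theorem continuous_cutoff (hR : 0 < R) : Continuous (cutoff R) :=
  continuous_const.div (by fun_prop) fun t => by positivity

theorem cutoff_mul_add_mul_cutoff_le (hR : 0 < R) (t : ℝ) :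
    cutoff R t * (R + t) * cutoff R t ≤ R := by
  have key : R - cutoff R t * (R + t) * cutoff R t =
      R * t ^ 2 * ((t + 2 * R) ^ 2 + 8 * R ^ 2) / ((t + R) ^ 2 + 3 * R ^ 2) ^ 2 := by
    rw [cutoff]
    field_simp
    ring
  rw [← sub_nonneg, key]
  positivity

theorem one_sub_cfc_cutoff_mem (hR : 0 < R) {s : B} (hs : s ∈ T) (hsa : IsSelfAdjoint s) :
    1 - cfc (cutoff R) s ∈ T := by
  have hg : Continuous fun t : ℝ => (t + 2 * R) / ((t + R) ^ 2 + 3 * R ^ 2) :=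
    Continuous.div (by fun_prop) (by fun_prop) fun t => by positivity
  have h : 1 - cfc (cutoff R) s = s * cfc (fun t => (t + 2 * R) / ((t + R) ^ 2 + 3 * R ^ 2)) s := by
    rw [funext (cutoff_eq hR), cfc_sub .., cfc_const_one ℝ s,
      cfc_mul (fun t => t) _ s (by fun_prop) hg.continuousOn, cfc_id' ℝ s, sub_sub_cancel]
  rw [h]
  exact T.mul_mem_right _ hs

variable [PartialOrder B] [StarOrderedRing B]

theorem infDist_sq_le_of_star_mul_self_le (hR : 0 < R) {s : B} (hs : s ∈ T) (hsa : IsSelfAdjoint s)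
    (hle : star c * c ≤ algebraMap ℝ B R + s) : Metric.infDist c T ^ 2 ≤ R := by
  set w := cfc (cutoff R) s
  have hwc := continuous_cutoff hR
  have hmem : c * (1 - w) ∈ T := T.mul_mem_left c (one_sub_cfc_cutoff_mem hR hs hsa)
  have hdist : Metric.infDist c T ≤ ‖c * w‖ := by
    simpa [dist_eq_norm, mul_sub] using Metric.infDist_le_dist_of_mem (x := c) hmem
  have hbound : star (c * w) * (c * w) ≤ algebraMap ℝ B R :=
    calc star (c * w) * (c * w) = star w * (star c * c) * w := by simp only [star_mul, mul_assoc]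
      _ ≤ star w * (algebraMap ℝ B R + s) * w := star_left_conjugate_le_conjugate hle w
      _ = cfc (fun t => cutoff R t * (R + t) * cutoff R t) s := by
        rw [cfc_mul .., cfc_mul .., cfc_const_add .., cfc_id' ℝ s,
          (cfc_predicate _ s : IsSelfAdjoint w).star_eq]
      _ ≤ algebraMap ℝ B R := cfc_le_algebraMap _ _ _ fun t _ => cutoff_mul_add_mul_cutoff_le hR t
  calc Metric.infDist c T ^ 2 ≤ ‖c * w‖ ^ 2 := by gcongr; exact Metric.infDist_nonneg
    _ = ‖star (c * w) * (c * w)‖ := by rw [CStarRing.norm_star_mul_self, sq]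
    _ ≤ R := (CStarAlgebra.norm_le_iff_le_algebraMap _ hR.le (star_mul_self_nonneg _)).2 hbound

theorem star_mem_of_isClosed (hT : IsClosed (T : Set B)) {s : B} (hs : s ∈ T) : star s ∈ T := by
  have h : ∀ R > 0, Metric.infDist (star s) T ^ 2 ≤ R := fun R hR =>
    infDist_sq_le_of_star_mul_self_le hR (T.mul_mem_right (star s) hs)
      (.mul_star_self s) (by
        rw [star_star]
        exact le_add_of_nonneg_left (algebraMap_nonneg B hR.le))
  have h0 : Metric.infDist (star s) T = 0 :=
    pow_eq_zero_iff two_ne_zero |>.1 (le_antisymm (le_of_forall_gt_imp_ge_of_dense h) (sq_nonneg _))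
  exact (hT.mem_iff_infDist_zero ⟨s, hs⟩).2 h0

theorem realPart_mem_of_isClosed (hT : IsClosed (T : Set B)) {s : B} (hs : s ∈ T) :
    (ℜ s : B) ∈ T := by
  rw [realPart_apply_coe]
  exact T.smul_of_tower_mem _ (T.add_mem hs (star_mem_of_isClosed hT hs))

end IdealDistance

section StateCone

variable {B : Type*} [CStarAlgebra B] [PartialOrder B] [StarOrderedRing B] {T : Ideal B}

/-- The closed real cone spanned by the positive elements, the ideal `T` and the skew-adjoint
elements; the states vanishing on `T` arise from the real functionals that are nonnegative on it. -/
noncomputable def stateCone (T : Ideal B) : ProperCone ℝ B :=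
  Submodule.closure (PointedCone.positive ℝ B ⊔ (T.restrictScalars ℝ : PointedCone ℝ B) ⊔
    (skewAdjoint.submodule ℝ B : PointedCone ℝ B))

theorem mem_stateCone_of_nonneg {p : B} (hp : 0 ≤ p) : p ∈ stateCone T :=
  subset_closure (Submodule.mem_sup_left (Submodule.mem_sup_left hp))

theorem mem_stateCone_of_mem {s : B} (hs : s ∈ T) : s ∈ stateCone T :=
  subset_closure (Submodule.mem_sup_left (Submodule.mem_sup_right hs))

theorem mem_stateCone_of_mem_skewAdjoint {k : B} (hk : k ∈ skewAdjoint B) : k ∈ stateCone T :=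
  subset_closure (Submodule.mem_sup_right hk)

theorem exists_realPart_sub_le_of_mem_stateCone {x : B} (hx : x ∈ stateCone T) {δ : ℝ}
    (hδ : 0 < δ) : ∃ s ∈ T, (ℜ s : B) - algebraMap ℝ B δ ≤ ℜ x := by
  obtain ⟨y, hy, hxy⟩ := Metric.mem_closure_iff.1 hx δ hδ
  obtain ⟨z, hz, k, hk, rfl⟩ := Submodule.mem_sup.1 hy
  obtain ⟨p, hp, s, hs, rfl⟩ := Submodule.mem_sup.1 hz
  refine ⟨s, hs, ?_⟩
  have hk0 : ℜ k = 0 := Subtype.ext (by simp [realPart_apply_coe, skewAdjoint.mem_iff.1 hk])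
  have hre : (ℜ x : B) = ℜ s + p + ℜ (x - (p + s + k)) := by
    simp only [map_sub, map_add, hk0, AddSubgroup.coe_sub, AddSubgroup.coe_add, add_zero,
      (IsSelfAdjoint.of_nonneg hp).coe_realPart]
    abel
  have hnorm : ‖(ℜ (x - (p + s + k)) : B)‖ ≤ δ :=
    (realPart.norm_le _).trans (dist_eq_norm x _ ▸ hxy.le)
  calc (ℜ s : B) - algebraMap ℝ B δ ≤ ℜ s + p - algebraMap ℝ B δ := by
        gcongr; exact le_add_of_nonneg_right hp
    _ ≤ ℜ s + p - algebraMap ℝ B ‖(ℜ (x - (p + s + k)) : B)‖ := by gcongr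
    _ ≤ ℜ x := by
        rw [hre, sub_eq_add_neg]
        gcongr
        exact (ℜ (x - (p + s + k))).2.neg_algebraMap_norm_le_self

theorem infDist_sq_le_of_mem_stateCone [T.IsTwoSided] (hT : IsClosed (T : Set B)) {c : B} {R : ℝ}
    (hR : 0 ≤ R) (h : algebraMap ℝ B R - star c * c ∈ stateCone T) :
    Metric.infDist c T ^ 2 ≤ R := by
  refine le_of_forall_pos_le_add fun δ hδ => ?_
  obtain ⟨s, hs, hle⟩ := exists_realPart_sub_le_of_mem_stateCone h hδ
  refine infDist_sq_le_of_star_mul_self_le (s := -ℜ s) (by positivity)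
    (T.neg_mem (realPart_mem_of_isClosed hT hs)) (ℜ s).2.neg ?_
  rw [((IsSelfAdjoint.algebraMap B (.all R)).sub (.star_mul_self c)).coe_realPart,
    sub_le_sub_iff] at hle
  rw [map_add, ← sub_eq_add_neg, le_sub_iff_add_le, add_comm]
  exact hle

theorem exists_mem_statesVanishingOn_of_nonneg {f : StrongDual ℝ B}
    (hf : ∀ x ∈ stateCone T, 0 ≤ f x) (h1 : 0 < f 1) :
    ∃ φ ∈ statesVanishingOn (T : Set B), ∀ x, (φ x).re = (f 1)⁻¹ * f x := by
  have hT {s : B} (hs : s ∈ T) : f s = 0 :=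
    le_antisymm (by simpa using hf _ (mem_stateCone_of_mem (T.neg_mem hs)))
      (hf _ (mem_stateCone_of_mem hs))
  have hskew {k : B} (hk : k ∈ skewAdjoint B) : f k = 0 :=
    le_antisymm (by simpa using hf _ (mem_stateCone_of_mem_skewAdjoint (neg_mem hk)))
      (hf _ (mem_stateCone_of_mem_skewAdjoint hk))
  let F : StrongDual ℂ B := f.extendRCLike
  have hF (x : B) : F x = f x - Complex.I * f (Complex.I • x) := f.extendRCLike_apply x
  have hFsa {x : B} (hx : IsSelfAdjoint x) : F x = f x := by
    rw [hF, hskew (hx.smul_mem_skewAdjoint Complex.conj_I)]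
    simp
  let φ : WeakDual ℂ B := (f 1 : ℂ)⁻¹ • F
  have hφ (x : B) : φ x = (f 1 : ℂ)⁻¹ * F x := rfl
  refine ⟨φ, ⟨fun x hx => ?_, ?_, fun s hs => ?_⟩, fun x => ?_⟩
  · rw [hφ, hFsa (.of_nonneg hx)]
    have := hf x (mem_stateCone_of_nonneg hx)
    exact_mod_cast mul_nonneg (inv_nonneg.2 h1.le) this
  · rw [hφ, hFsa (.one B), inv_mul_cancel₀ (by exact_mod_cast h1.ne')]
  · rw [hφ, hF, hT hs, hT (T.smul_of_tower_mem _ hs)]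
    simp
  · rw [hφ, hF]
    simp [← Complex.ofReal_inv]

theorem exists_mem_statesVanishingOn_lt [T.IsTwoSided] (hT : IsClosed (T : Set B)) {c : B} {R : ℝ}
    (hR : 0 ≤ R) (h : R < Metric.infDist c T ^ 2) :
    ∃ φ ∈ statesVanishingOn (T : Set B), R < (φ (star c * c)).re := by
  obtain ⟨f, hf, hfc⟩ := ProperCone.hyperplane_separation_point (stateCone T)
    (mt (infDist_sq_le_of_mem_stateCone hT hR) h.not_ge)
  have hRc : R * f 1 < f (star c * c) := by
    simpa [Algebra.algebraMap_eq_smul_one] using hfc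
  have hcle : f (star c * c) ≤ ‖star c * c‖ * f 1 := by
    simpa [Algebra.algebraMap_eq_smul_one] using hf _ <| mem_stateCone_of_nonneg <|
      sub_nonneg.2 (IsSelfAdjoint.star_mul_self c).le_algebraMap_norm_self
  have h1 : 0 < f 1 := by
    refine lt_of_le_of_ne (hf 1 (mem_stateCone_of_nonneg zero_le_one)) fun h0 => ?_
    rw [← h0, mul_zero] at hRc hcle
    exact hRc.not_ge hcle
  obtain ⟨φ, hφ, hφf⟩ := exists_mem_statesVanishingOn_of_nonneg hf h1
  exact ⟨φ, hφ, by rwa [hφf, lt_inv_mul_iff₀' h1]⟩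

end StateCone

section ExtremeStates

theorem exists_mem_extremePoints_isMaxOn {E : Type*} [AddCommGroup E] [Module ℝ E]
    [TopologicalSpace E] [IsTopologicalAddGroup E] [ContinuousSMul ℝ E] [LocallyConvexSpace ℝ E]
    [T2Space E] {s : Set E} (hs : IsCompact s) (hne : s.Nonempty) (l : StrongDual ℝ E) :
    ∃ x ∈ s.extremePoints ℝ, IsMaxOn l s x := by
  have hF : IsExposed ℝ s (l.toExposed s) := ContinuousLinearMap.toExposed.isExposed
  obtain ⟨z, hz⟩ := hs.exists_isMaxOn hne l.continuous.continuousOn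
  obtain ⟨x, hx⟩ := (hF.isCompact hs).extremePoints_nonempty ⟨z, hz⟩
  exact ⟨x, hF.isExtreme.extremePoints_subset_extremePoints hx, hx.1.2⟩

theorem exists_mem_extremePoints_infDist_sq_le {B : Type*} [CStarAlgebra B] [PartialOrder B]
    [StarOrderedRing B] {T : Ideal B} [T.IsTwoSided] (hT : IsClosed (T : Set B)) {c : B}
    (hc : 0 < Metric.infDist c T) :
    ∃ ψ ∈ (statesVanishingOn (T : Set B)).extremePoints ℝ,
      Metric.infDist c T ^ 2 ≤ (ψ (star c * c)).re := by
  have : LocallyConvexSpace ℝ (WeakDual ℂ B) :=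
    inferInstanceAs (LocallyConvexSpace ℝ (WeakBilin (topDualPairing ℂ B)))
  let l : StrongDual ℝ (WeakDual ℂ B) :=
    { toFun φ := (φ (star c * c)).re
      map_add' _ _ := rfl
      map_smul' r φ := Complex.smul_re r (φ (star c * c))
      cont := Complex.continuous_re.comp (WeakDual.eval_continuous (star c * c)) }
  obtain ⟨φ₀, hφ₀, -⟩ := exists_mem_statesVanishingOn_lt hT le_rfl (pow_pos hc 2)
  obtain ⟨ψ, hψ, hmax⟩ :=
    exists_mem_extremePoints_isMaxOn (isCompact_statesVanishingOn (T : Set B)) ⟨φ₀, hφ₀⟩ l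
  refine ⟨ψ, hψ, le_of_forall_lt_imp_le_of_dense fun R hR => ?_⟩
  obtain ⟨φ, hφ, hRφ⟩ :=
    exists_mem_statesVanishingOn_lt hT (le_max_left 0 R) (max_lt (pow_pos hc 2) hR)
  exact (le_max_right 0 R).trans (hRφ.le.trans (hmax hφ))

end ExtremeStates

section QuotientNorm

variable {A : Type u} [NonUnitalCStarAlgebra A] {x y : A} {I J : TwoSidedIdeal A}

theorem quotientNorm_eq_infDist (x : A) (I : TwoSidedIdeal A) :
    quotientNorm x I = Metric.infDist x I :=
  QuotientAddGroup.norm_mk x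

theorem quotientNorm_anti (x : A) (h : I ≤ J) : quotientNorm x J ≤ quotientNorm x I := by
  simp only [quotientNorm_eq_infDist]
  exact Metric.infDist_le_infDist_of_subset h ⟨0, I.zero_mem⟩

theorem quotientNorm_lt_iff {ε : ℝ} : quotientNorm x I < ε ↔ ∃ y ∈ I, ‖x - y‖ < ε := by
  rw [quotientNorm_eq_infDist, Metric.infDist_lt_iff ⟨0, I.zero_mem⟩]
  simp [dist_eq_norm]

theorem norm_apply_le_quotientNorm {C : Type*} [NonUnitalCStarAlgebra C] (π : A →⋆ₙₐ[ℂ] C)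
    (x : A) : ‖π x‖ ≤ quotientNorm x (TwoSidedIdeal.ker π) := by
  refine le_of_forall_gt_imp_ge_of_dense fun ε hε => ?_
  obtain ⟨y, hy, hxy⟩ := quotientNorm_lt_iff.1 hε
  calc ‖π x‖ = ‖π (x - y)‖ := by rw [map_sub, (TwoSidedIdeal.mem_ker π).1 hy, sub_zero]
    _ ≤ ‖x - y‖ := NonUnitalStarAlgHom.norm_apply_le π _
    _ ≤ ε := hxy.le

end QuotientNorm

section ClosedIdeal

variable {A : Type u} [NonUnitalCStarAlgebra A] {x y : A} {I : TwoSidedIdeal A}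

theorem add_mem_closure (hx : x ∈ closure (I : Set A)) (hy : y ∈ closure (I : Set A)) :
    x + y ∈ closure (I : Set A) :=
  map_mem_closure₂ continuous_add hx hy fun _ hs _ ht => I.add_mem hs ht

theorem mul_mem_closure_left (x : A) (hy : y ∈ closure (I : Set A)) :
    x * y ∈ closure (I : Set A) :=
  map_mem_closure (continuous_const_mul x) hy fun s hs => I.mul_mem_left x s hs

theorem mul_mem_closure_right (hx : x ∈ closure (I : Set A)) (y : A) :
    x * y ∈ closure (I : Set A) :=
  map_mem_closure (f := (· * y)) (continuous_mul_const y) hx fun s hs => I.mul_mem_right s y hs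

theorem smul_mem_closure (r : ℂ) (hx : x ∈ closure (I : Set A)) : r • x ∈ closure (I : Set A) := by
  let := CStarAlgebra.spectralOrder A
  have := CStarAlgebra.spectralOrderedRing A
  refine closure_closure.subset (map_mem_closure (continuous_const_smul r) hx fun s hs => ?_)
  have hlim : Tendsto (fun e => r • e * s) (CStarAlgebra.approximateUnit A) (𝓝 (r • s)) := by
    simpa only [smul_mul_assoc] using
      ((CStarAlgebra.increasingApproximateUnit A).tendsto_mul_right s).const_smul r
  exact mem_closure_of_tendsto hlim (.of_forall fun e => I.mul_mem_left _ s hs)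

/-- The closure of an ideal of `A`, as an ideal of the unitization of `A`. -/
noncomputable def closureIdeal (I : TwoSidedIdeal A) : Ideal (Unitization ℂ A) where
  carrier := {y | y.fst = 0 ∧ y.snd ∈ closure (I : Set A)}
  add_mem' hy hz := ⟨by simp [hy.1, hz.1], add_mem_closure hy.2 hz.2⟩
  zero_mem' := ⟨rfl, subset_closure I.zero_mem⟩
  smul_mem' z y hy := ⟨by simp [hy.1], by
    simpa [hy.1] using
      add_mem_closure (smul_mem_closure z.fst hy.2) (mul_mem_closure_left z.snd hy.2)⟩

instance : (closureIdeal I).IsTwoSided where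
  mul_mem_of_left z hy := ⟨by simp [hy.1], by
    simpa [hy.1] using
      add_mem_closure (smul_mem_closure z.fst hy.2) (mul_mem_closure_right hy.2 z.snd)⟩

theorem closureIdeal_eq_image (I : TwoSidedIdeal A) :
    (closureIdeal I : Set (Unitization ℂ A)) = (↑) '' closure (I : Set A) := by
  ext y
  refine ⟨fun hy => ⟨y.snd, hy.2, Unitization.ext hy.1.symm rfl⟩, ?_⟩
  rintro ⟨s, hs, rfl⟩
  exact ⟨rfl, hs⟩

theorem isClosed_closureIdeal (I : TwoSidedIdeal A) :
    IsClosed (closureIdeal I : Set (Unitization ℂ A)) := by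
  rw [closureIdeal_eq_image]
  exact (Unitization.isometry_inr (𝕜 := ℂ)).isClosedEmbedding.isClosedMap _ isClosed_closure

theorem infDist_closureIdeal (x : A) (I : TwoSidedIdeal A) :
    Metric.infDist (x : Unitization ℂ A) (closureIdeal I) = quotientNorm x I := by
  rw [closureIdeal_eq_image, Metric.infDist_image (Unitization.isometry_inr (𝕜 := ℂ)),
    Metric.infDist_closure, quotientNorm_eq_infDist]

end ClosedIdeal

section PrimitiveIdeals

variable {A : Type u} [NonUnitalCStarAlgebra A] {x : A} {I : TwoSidedIdeal A}

theorem isIrreducibleRep_comp_inr {H : Type u} [NormedAddCommGroup H] [InnerProductSpace ℂ H]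
    [CompleteSpace H] {π : Unitization ℂ A →⋆ₐ[ℂ] (H →L[ℂ] H)} (hx : π x ≠ 0)
    (hπ : ∀ V : Submodule ℂ H, IsClosed (V : Set H) → (∀ y, ∀ v ∈ V, π y v ∈ V) → V = ⊥ ∨ V = ⊤) :
    IsIrreducibleRep
      ((π : Unitization ℂ A →⋆ₙₐ[ℂ] (H →L[ℂ] H)).comp
        (Unitization.inrNonUnitalStarAlgHom ℂ A)) := by
  refine ⟨⟨x, hx⟩, fun V hV hinv => hπ V hV fun y v hv => ?_⟩
  induction y using Unitization.ind with
  | inl_add_inr r y =>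
    have : π (Unitization.inl r + (y : Unitization ℂ A)) v = r • v + π y v := by
      rw [map_add, ← Unitization.algebraMap_eq_inl, AlgHomClass.commutes,
        Algebra.algebraMap_eq_smul_one]
      rfl
    rw [this]
    exact V.add_mem (V.smul_mem r hv) (hinv y v hv)

theorem exists_prim_quotientNorm_eq (h : 0 < quotientNorm x I) :
    ∃ P : Prim A, I ≤ P.1 ∧ quotientNorm x P.1 = quotientNorm x I := by
  obtain ⟨ψ, hψ, hxψ⟩ := exists_mem_extremePoints_infDist_sq_le (isClosed_closureIdeal I)
    (c := (x : Unitization ℂ A)) ((infDist_closureIdeal x I).symm ▸ h)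
  obtain ⟨f, hf⟩ := exists_positiveLinearMap_eq hψ.1.1
  obtain rfl : vectorFunctional f.gnsStarAlgHom (cyclicVector f) = ψ :=
    DFunLike.ext _ _ fun y => by rw [vectorFunctional_cyclicVector, hf]
  set π := f.gnsStarAlgHom
  set Ω := cyclicVector f
  have hΩ : ‖Ω‖ = 1 := norm_eq_one_of_vectorFunctional_one hψ.1.2.1
  have hker : ∀ s ∈ closureIdeal I, π s = 0 := fun s hs =>
    gnsStarAlgHom_eq_zero f (fun s hs => by rw [hf]; exact hψ.1.2.2 s hs) hs
  have hπx : quotientNorm x I ≤ ‖π x‖ := by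
    rw [infDist_closureIdeal, vectorFunctional_star_mul_self] at hxψ
    have hle : quotientNorm x I ^ 2 ≤ ‖π x Ω‖ ^ 2 := by exact_mod_cast hxψ
    calc quotientNorm x I ≤ ‖π x Ω‖ := le_of_sq_le_sq hle (norm_nonneg _)
      _ ≤ ‖π x‖ := by simpa [hΩ] using (π x).le_opNorm Ω
  have hirr := isIrreducibleRep_comp_inr (norm_pos_iff.1 (h.trans_le hπx)) fun V =>
    eq_bot_or_eq_top_of_mem_extremePoints hker (denseRange_gnsStarAlgHom_cyclicVector f) hψ
  set ρ := (π : Unitization ℂ A →⋆ₙₐ[ℂ] (f.GNS →L[ℂ] f.GNS)).comp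
    (Unitization.inrNonUnitalStarAlgHom ℂ A)
  have hI : I ≤ TwoSidedIdeal.ker ρ := fun s hs =>
    (TwoSidedIdeal.mem_ker ρ).2 (hker s ⟨rfl, subset_closure hs⟩)
  exact ⟨⟨TwoSidedIdeal.ker ρ, f.GNS, _, _, inferInstance, ρ, hirr, rfl⟩, hI,
    (quotientNorm_anti x hI).antisymm (hπx.trans (norm_apply_le_quotientNorm ρ x))⟩

end PrimitiveIdeals

section PrimitiveSpectrum

variable {A : Type u} [NonUnitalCStarAlgebra A] {x : A} {ε : ℝ}

theorem isOpen_setOf_notMem (x : A) : IsOpen {P : Prim A | x ∉ P.1} := by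
  rw [← isClosed_compl_iff, isClosed_iff_hull]
  refine ⟨TwoSidedIdeal.span {x}, ?_⟩
  ext P
  simp [hull, TwoSidedIdeal.span_le]

theorem mem_of_isClosed_of_forall_mem {F : Set (Prim A)} (hF : IsClosed F) {P : Prim A}
    (h : ∀ y, (∀ Q ∈ F, y ∈ Q.1) → y ∈ P.1) : P ∈ F := by
  obtain ⟨I, rfl⟩ := isClosed_iff_hull.1 hF
  exact fun y hy => h y fun Q hQ => hQ hy

open scoped Classical in
/-- The ideal of the elements that vanish outside finitely many of the sets `U i`, an element `y`
being regarded as the function `P ↦ y + P` on `Prim A`. -/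
noncomputable def finitelySupportedIdeal {ι : Type*} (U : ι → Set (Prim A)) : TwoSidedIdeal A :=
  .mk' {y | ∃ t : Finset ι, ∀ P : Prim A, (∀ i ∈ t, P ∉ U i) → y ∈ P.1}
    ⟨∅, fun P _ => P.1.zero_mem⟩
    (fun ⟨s, hs⟩ ⟨t, ht⟩ => ⟨s ∪ t, fun P hP => P.1.add_mem
      (hs P fun i hi => hP i (Finset.mem_union_left t hi))
      (ht P fun i hi => hP i (Finset.mem_union_right s hi))⟩)
    (fun ⟨t, ht⟩ => ⟨t, fun P hP => P.1.neg_mem (ht P hP)⟩)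
    (fun ⟨t, ht⟩ => ⟨t, fun P hP => P.1.mul_mem_left _ _ (ht P hP)⟩)
    (fun ⟨t, ht⟩ => ⟨t, fun P hP => P.1.mul_mem_right _ _ (ht P hP)⟩)

theorem mem_finitelySupportedIdeal {ι : Type*} {U : ι → Set (Prim A)} {y : A} :
    y ∈ finitelySupportedIdeal U ↔
      ∃ t : Finset ι, ∀ P : Prim A, (∀ i ∈ t, P ∉ U i) → y ∈ P.1 := by
  simp [finitelySupportedIdeal]

theorem notMem_of_finitelySupportedIdeal_le {ι : Type*} {U : ι → Set (Prim A)}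
    (hU : ∀ i, IsOpen (U i)) {P : Prim A} (hP : finitelySupportedIdeal U ≤ P.1) (i : ι) :
    P ∉ U i :=
  mem_of_isClosed_of_forall_mem (hU i).isClosed_compl fun _ hy =>
    hP (mem_finitelySupportedIdeal.2 ⟨{i}, fun Q hQ => hy Q (hQ i (Finset.mem_singleton_self i))⟩)

theorem isCompact_setOf_le_quotientNorm (x : A) (hε : 0 < ε) :
    IsCompact {P : Prim A | ε ≤ quotientNorm x P.1} := by
  refine isCompact_of_finite_subcover fun {ι} U hU hcov => ?_
  have hlt : quotientNorm x (finitelySupportedIdeal U) < ε := by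
    by_contra! hle
    obtain ⟨P, hIP, hP⟩ := exists_prim_quotientNorm_eq (hε.trans_le hle)
    obtain ⟨i, hi⟩ := Set.mem_iUnion.1 (hcov (show ε ≤ quotientNorm x P.1 from hP ▸ hle))
    exact notMem_of_finitelySupportedIdeal_le hU hIP i hi
  obtain ⟨y, hy, hxy⟩ := quotientNorm_lt_iff.1 hlt
  obtain ⟨t, ht⟩ := mem_finitelySupportedIdeal.1 hy
  refine ⟨t, fun P hP => ?_⟩
  by_contra! hPt
  have hyP : y ∈ P.1 := ht P (by simpa using hPt)
  exact (quotientNorm_lt_iff.2 ⟨y, hyP, hxy⟩).not_ge hP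

/-- The factor `1 - ε ^ 2 / |t|` for `ε ^ 2 ≤ |t|`, extended by `0`. -/
noncomputable def shrinkFactor (ε t : ℝ) : ℝ := 1 - ε ^ 2 / max (ε ^ 2) |t|

theorem shrinkFactor_eq_zero (hε : 0 < ε) {t : ℝ} (ht : |t| ≤ ε ^ 2) : shrinkFactor ε t = 0 := by
  rw [shrinkFactor, max_eq_left ht, div_self (by positivity), sub_self]

theorem continuous_shrinkFactor (hε : 0 < ε) : Continuous (shrinkFactor ε) :=
  continuous_const.sub (continuous_const.div (by fun_prop) fun t => by positivity)

theorem abs_mul_one_sub_shrinkFactor_sq_le (hε : 0 < ε) (t : ℝ) :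
    |t * (1 - shrinkFactor ε t) ^ 2| ≤ ε ^ 2 := by
  have h1 : (1 - shrinkFactor ε t) ^ 2 ≤ 1 - shrinkFactor ε t := by
    rw [shrinkFactor, sub_sub_cancel]
    exact pow_le_of_le_one (by positivity) (div_le_one_of_le₀ (le_max_left ..) (by positivity))
      two_ne_zero
  calc |t * (1 - shrinkFactor ε t) ^ 2| = |t| * (1 - shrinkFactor ε t) ^ 2 := by
        rw [abs_mul, abs_sq]
    _ ≤ max (ε ^ 2) |t| * (1 - shrinkFactor ε t) := by gcongr; exact le_max_right ..
    _ = ε ^ 2 := by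
        rw [shrinkFactor, sub_sub_cancel, mul_div_cancel₀ _ (by positivity)]

/-- A perturbation of `x` of size at most `ε` that vanishes in exactly those quotients in which the
norm of `x` is at most `ε`. -/
noncomputable def shrink (ε : ℝ) (x : A) : A := x * cfcₙ (shrinkFactor ε) (star x * x)

theorem norm_sub_shrink_le (hε : 0 < ε) (x : A) : ‖x - shrink ε x‖ ≤ ε := by
  have hc := continuous_shrinkFactor hε
  have h0 : shrinkFactor ε 0 = 0 := shrinkFactor_eq_zero hε (by simpa using sq_nonneg ε)
  have hsa : IsSelfAdjoint (cfcₙ (shrinkFactor ε) (star x * x)) := cfcₙ_predicate _ _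
  have hsq : star (x - shrink ε x) * (x - shrink ε x) =
      cfcₙ (fun t => t * (1 - shrinkFactor ε t) ^ 2) (star x * x) := by
    have hexp : (fun t => t * (1 - shrinkFactor ε t) ^ 2) = fun t =>
        t - t * shrinkFactor ε t -
          (shrinkFactor ε t * t - shrinkFactor ε t * t * shrinkFactor ε t) :=
      funext fun t => by ring
    rw [hexp, cfcₙ_sub .., cfcₙ_sub .., cfcₙ_sub .., cfcₙ_mul .., cfcₙ_mul .., cfcₙ_mul ..,
      cfcₙ_mul .., cfcₙ_id' ℝ (star x * x), shrink, star_sub, star_mul, hsa.star_eq]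
    noncomm_ring
  refine le_of_sq_le_sq ?_ hε.le
  calc ‖x - shrink ε x‖ ^ 2 = ‖star (x - shrink ε x) * (x - shrink ε x)‖ := by
        rw [CStarRing.norm_star_mul_self, sq]
    _ ≤ ε ^ 2 := by
        rw [hsq]
        exact norm_cfcₙ_le fun t _ => abs_mul_one_sub_shrinkFactor_sq_le hε t

theorem shrink_eq_zero (hε : 0 < ε) (hx : ‖x‖ ≤ ε) : shrink ε x = 0 := by
  have hnorm : ‖star x * x‖ ≤ ε ^ 2 := by
    rw [CStarRing.norm_star_mul_self, ← sq]
    gcongr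
  have h : cfcₙ (shrinkFactor ε) (star x * x) = 0 := by
    rw [cfcₙ_congr (g := 0) fun t ht => shrinkFactor_eq_zero hε ?_, cfcₙ_zero]
    exact (NonUnitalIsometricContinuousFunctionalCalculus.norm_quasispectrum_le
      (star x * x) ht (.star_mul_self x)).trans hnorm
  rw [shrink, h, mul_zero]

theorem map_shrink {C : Type*} [NonUnitalCStarAlgebra C] (π : A →⋆ₙₐ[ℂ] C) (hε : 0 < ε) (x : A) :
    π (shrink ε x) = shrink ε (π x) := by
  have hπ : Continuous π := map_continuous π
  rw [shrink, shrink, map_mul, NonUnitalStarAlgHomClass.map_cfcₙ π (shrinkFactor ε) (star x * x)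
    (continuous_shrinkFactor hε).continuousOn (shrinkFactor_eq_zero hε (by simpa using sq_nonneg ε))
    hπ (.star_mul_self x) (by rw [map_mul, map_star]; exact .star_mul_self (π x)),
    map_mul, map_star]

theorem shrink_mem_iff (hε : 0 < ε) {P : Prim A} : shrink ε x ∈ P.1 ↔ quotientNorm x P.1 ≤ ε := by
  constructor
  · intro h
    rw [quotientNorm_eq_infDist]
    exact (Metric.infDist_le_dist_of_mem h).trans
      ((dist_eq_norm x _).trans_le (norm_sub_shrink_le hε x))
  · obtain ⟨_, H, _, _, _, π, -, rfl⟩ := P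
    intro h
    rw [TwoSidedIdeal.mem_ker, map_shrink π hε,
      shrink_eq_zero hε ((norm_apply_le_quotientNorm π x).trans h)]

theorem isOpen_setOf_lt_quotientNorm (x : A) (hε : 0 < ε) :
    IsOpen {P : Prim A | ε < quotientNorm x P.1} := by
  simpa only [shrink_mem_iff hε, not_le] using isOpen_setOf_notMem (shrink ε x)

theorem Prim.isClosed (P : Prim A) : IsClosed (P.1 : Set A) := by
  obtain ⟨_, H, _, _, _, π, -, rfl⟩ := P
  have hπ : Continuous π := map_continuous π
  have hker : (TwoSidedIdeal.ker π : Set A) = {x | π x = 0} :=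
    Set.ext fun x => TwoSidedIdeal.mem_ker π
  rw [hker]
  exact isClosed_eq hπ continuous_const

theorem quotientNorm_pos {P : Prim A} (hx : x ∉ P.1) : 0 < quotientNorm x P.1 := by
  rw [quotientNorm_eq_infDist]
  exact (P.isClosed.notMem_iff_infDist_pos ⟨0, P.1.zero_mem⟩).1 hx

end PrimitiveSpectrum

section Glimm

variable {A : Type u} [NonUnitalCStarAlgebra A] {a : A}

theorem exists_continuous_eq_zero_one_lt {P Q : Prim A} (h : ¬Equivalent P Q) :
    ∃ g : Prim A → ℝ, Continuous g ∧ (∀ R, 0 ≤ g R) ∧ g P = 0 ∧ 1 < g Q := by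
  obtain ⟨f, hf⟩ := not_forall.1 h
  have hpos : 0 < |f Q - f P| := abs_pos.2 (sub_ne_zero.2 (Ne.symm hf))
  have hc := f.continuous
  refine ⟨fun R => 2 * |f R - f P| / |f Q - f P|, by fun_prop, fun R => by positivity, by simp, ?_⟩
  exact one_lt_two.trans_eq (mul_div_cancel_right₀ 2 hpos.ne').symm

theorem exists_continuous_eq_one_eqOn_zero {C : Set (Prim A)} (hC : IsCompact C) {P : Prim A}
    (hP : ∀ Q ∈ C, ¬Equivalent P Q) :
    ∃ f : Prim A → ℝ, Continuous f ∧ (∀ R, 0 ≤ f R) ∧ f P = 1 ∧ Set.EqOn f 0 C := by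
  choose! g hgc hg0 hgP hgQ using fun Q hQ => exists_continuous_eq_zero_one_lt (hP Q hQ)
  obtain ⟨t, htC, hCt⟩ := hC.elim_nhds_subcover (fun Q => {R | 1 < g Q R}) fun Q hQ =>
    (isOpen_lt continuous_const (hgc Q hQ)).mem_nhds (hgQ Q hQ)
  have hsum : Continuous fun R => ∑ Q ∈ t, g Q R :=
    continuous_finsetSum t fun Q hQ => hgc Q (htC Q hQ)
  refine ⟨fun R => max 0 (1 - ∑ Q ∈ t, g Q R), by fun_prop, fun R => le_max_left _ _, ?_,
    fun R hR => max_eq_left ?_⟩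
  · simp [Finset.sum_eq_zero fun Q hQ => hgP Q (htC Q hQ)]
  · obtain ⟨Q, hQt, hQ⟩ := Set.mem_iUnion₂.1 (hCt hR)
    rw [sub_nonpos]
    exact (show 1 < g Q R from hQ).le.trans
      (Finset.single_le_sum (fun Q hQ => hg0 Q (htC Q hQ) R) hQt)

theorem exists_continuous_eq_one_of_quotientNorm_lt {P : Prim A} {ε : ℝ} (hε : 0 < ε)
    (hP : quotientNorm a (glimmIdeal P) < ε) :
    ∃ f : Prim A → ℝ, Continuous f ∧ (∀ R, 0 ≤ f R) ∧ f P = 1 ∧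
      Set.EqOn f 0 {R | ε ≤ quotientNorm a R.1} := by
  refine exists_continuous_eq_one_eqOn_zero (isCompact_setOf_le_quotientNorm a hε)
    fun Q hQ hPQ => ?_
  have hle : glimmIdeal P ≤ Q.1 := sInf_le ⟨Q, hPQ, rfl⟩
  exact ((quotientNorm_anti a hle).trans_lt hP).not_ge hQ

theorem locallyFinite_support_of_eqOn_zero (ha : ∀ P : Prim A, a ∉ P.1) {ε : ℕ → ℝ}
    (hε : Tendsto ε atTop (𝓝 0)) {f : ℕ → Prim A → ℝ}
    (hf : ∀ n, Set.EqOn (f n) 0 {R | ε n ≤ quotientNorm a R.1}) :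
    LocallyFinite fun n => Function.support (f n) := by
  intro P
  obtain ⟨δ, hδ0, hδ⟩ := exists_between (quotientNorm_pos (ha P))
  refine ⟨_, (isOpen_setOf_lt_quotientNorm a hδ0).mem_nhds hδ, ?_⟩
  obtain ⟨N, hN⟩ := eventually_atTop.1 (hε.eventually_le_const hδ0)
  refine (Set.finite_lt_nat N).subset ?_
  rintro n ⟨R, hR, hRδ⟩
  by_contra hn
  exact hR (hf n ((hN n (not_lt.1 hn)).trans (show δ < quotientNorm a R.1 from hRδ).le))

theorem quotientMap_surjective : Function.Surjective (quotientMap (A := A)) := by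
  rintro ⟨_, P, rfl⟩
  exact ⟨P, rfl⟩

theorem exists_continuous_comp_quotientMap (f : Prim A →ᵇ ℝ) :
    ∃ g : Glimm A → ℝ, Continuous g ∧ ∀ P, g (quotientMap P) = f P := by
  let r := Function.surjInv (quotientMap_surjective (A := A))
  have hg (P : Prim A) : f (r (quotientMap P)) = f P :=
    quotientMap_eq_iff.1 (Function.surjInv_eq quotientMap_surjective (quotientMap P)) f
  exact ⟨fun G => f (r G), continuous_iff_le_induced.2 (iInf₂_le _ ⟨f, hg⟩), hg⟩

theorem bddAbove_image_preimage_quotientMap {K : Set (Glimm A)} (hK : IsCompact K)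
    {F : Prim A → ℝ} (hF : Continuous F) : BddAbove (F '' (quotientMap ⁻¹' K)) := by
  -- `F` need not be bounded, but `arctan ∘ F` drops to `Glimm A`, where it has a maximum on `K`.
  obtain ⟨g, hg, hgF⟩ := exists_continuous_comp_quotientMap <|
    BoundedContinuousFunction.ofNormedAddCommGroup (fun P => Real.arctan (F P)) (by fun_prop)
      (Real.pi / 2) fun P => abs_le.2
        ⟨(Real.neg_pi_div_two_lt_arctan _).le, (Real.arctan_lt_pi_div_two _).le⟩
  obtain rfl | hne := K.eq_empty_or_nonempty
  · simp
  obtain ⟨G, -, hmax⟩ := hK.exists_isMaxOn hne hg.continuousOn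
  obtain ⟨P, rfl⟩ := quotientMap_surjective G
  refine ⟨F P, ?_⟩
  rintro _ ⟨Q, hQ, rfl⟩
  have hle : g (quotientMap Q) ≤ g (quotientMap P) := hmax hQ
  rw [hgF, hgF] at hle
  exact Real.arctan_strictMono.le_iff_le.1 hle

theorem IsStrictlyPositiveElement.notMem (ha : IsStrictlyPositiveElement a) (P : Prim A) :
    a ∉ P.1 := by
  intro haP
  have hsub : {y : A | ∃ x : A, y = a * x * a} ⊆ P.1 := by
    rintro _ ⟨x, rfl⟩
    exact P.1.mul_mem_left _ _ haP
  exact P.2.ne_top fun x _ => closure_minimal hsub P.isClosed (ha x)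

end Glimm

end GlimmSpace

open GlimmSpace

theorem theorem2p1_general {A : Type u} [NonUnitalCStarAlgebra A] {a : A}
    (ha : ∀ P : Prim A, a ∉ P.1) {K : Set (Glimm A)} (hK : IsCompact K) :
    ∃ α : ℝ, 0 < α ∧ K ⊆ {G : Glimm A | α ≤ quotientNorm a G.1} := by
  by_contra! hcon
  have hε (n : ℕ) : 0 < 1 / ((n : ℝ) + 1) := Nat.one_div_pos_of_nat
  have hex (n : ℕ) : ∃ P : Prim A, quotientMap P ∈ K ∧
      quotientNorm a (glimmIdeal P) < 1 / ((n : ℝ) + 1) := by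
    obtain ⟨G, hGK, hG⟩ := Set.not_subset.1 (hcon _ (hε n))
    obtain ⟨P, rfl⟩ := quotientMap_surjective G
    exact ⟨P, hGK, not_le.1 hG⟩
  choose P hPK hP using hex
  choose f hfc hf0 hfP hfz using fun n =>
    exists_continuous_eq_one_of_quotientNorm_lt (hε n) (hP n)
  have hfin : LocallyFinite fun n => Function.support fun Q => n * f n Q :=
    locallyFinite_support_of_eqOn_zero ha tendsto_one_div_add_atTop_nhds_zero_nat
      fun n Q hQ => by simp [hfz n hQ]
  obtain ⟨M, hM⟩ := bddAbove_image_preimage_quotientMap hK <|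
    continuous_finsum (fun n => continuous_const.mul (hfc n)) hfin
  obtain ⟨n, hn⟩ := exists_nat_gt M
  have hle : n * f n (P n) ≤ ∑ᶠ m : ℕ, m * f m (P n) :=
    single_le_finsum n (hfin.point_finite (P n)) fun m => mul_nonneg m.cast_nonneg (hf0 m (P n))
  rw [hfP, mul_one] at hle
  exact (hle.trans (hM ⟨P n, hPK n, rfl⟩)).not_gt hn

theorem theorem2p1 {A : Type u} [NonUnitalCStarAlgebra A]
    (hA : GlimmSpace.HasCountableApproximateIdentity A)
    (a : A) (ha : GlimmSpace.IsStrictlyPositiveElement a)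
    (K : Set (GlimmSpace.Glimm A)) (hK : IsCompact K) :
    ∃ α : ℝ, 0 < α ∧ K ⊆ {G : GlimmSpace.Glimm A | α ≤ GlimmSpace.quotientNorm a G.1} :=
  theorem2p1_general ha.notMem hK
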